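/- A (simple) $t$-graph $G$ on a finite vertex set $V$ is a set of $t$-element subsets of $V$, called edges. Let $v=|V|$. For $\epsilon\in\mathbb R$, $G$ is called $(1-\epsilon)$-dense if every $(t-1)$-element subset of $V$ is contained in at least $(1-\epsilon)(v-t+1)$ edges of $G$. For a $t$-graph $H$, a rational decomposition of $G$ into copies of $H$ is a finite set of pairs $(H_i,w_i)$, where each $H_i$ is a (not necessarily induced) subgraph of $G$ isomorphic to $H$ and each $w_i$ is a positive rational number, such that $\sum_{i:\,T\in E(H_i)} w_i = 1$ for every edge $T$ of $G$. Let $K_k^t$ denote the complete $t$-graph on $k$ vertices. Theorem. For every integer $t\ge 2$ there is a constant $C=C(t)>0$, and for every integer $k\ge t$ there is a $v_0=v_0(t,k)$, such that the following holds. For all $v>v_0$ and all real $\epsilon< C k^{-2t}$, every $(1-\epsilon)$-dense $t$-graph $G$ on $v$ vertices admits a rational decomposition into copies of $K_k^t$. Moreover, with the same $C$ and $v_0$, $G$ admits a rational decomposition into copies of $H$ for every $t$-graph $H$ on $k$ vertices with at least one edge. -/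

import Mathlib

/-- A simple `t`-uniform hypergraph (a `t`-graph) on the vertex type `V`: a finite set of edges,
each of which is a set of exactly `t` vertices. -/
structure TGraph (t : ℕ) (V : Type*) where
  /-- the edges -/
  edges : Finset (Finset V)
  /-- every edge has exactly `t` vertices -/
  card_edge : ∀ T ∈ edges, T.card = t

namespace TGraph

/-- The complete `t`-graph on a finite vertex type. -/
def complete (t : ℕ) (V : Type*) [Fintype V] : TGraph t V where
  edges := Finset.powersetCard t Finset.univ
  card_edge := fun _ hT => (Finset.mem_powersetCard.mp hT).2

/-- The degree of a set `S` of vertices: the number of edges that contain `S`. -/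
def degree {t : ℕ} {V : Type*} [DecidableEq V] (G : TGraph t V) (S : Finset V) : ℕ :=
  (G.edges.filter (fun T => S ⊆ T)).card

/-- The minimum degree of `G` over all `s`-element sets of vertices. -/
noncomputable def minDegree {t : ℕ} {V : Type*} [DecidableEq V] (G : TGraph t V) (s : ℕ) : ℕ :=
  sInf {d : ℕ | ∃ S : Finset V, S.card = s ∧ G.degree S = d}

/-- `G` is `(1 - ε)`-dense: the minimum degree over `(t-1)`-element sets of vertices is at least
`(1 - ε) (v - t + 1)`, where `v` is the number of vertices. -/
def IsDense {t : ℕ} {V : Type*} [Fintype V] [DecidableEq V] (G : TGraph t V) (ε : ℝ) : Prop :=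
  (1 - ε) * ((Fintype.card V : ℝ) - (t : ℝ) + 1) ≤ (G.minDegree (t - 1) : ℝ)

/-- A (not necessarily induced) subgraph of `G`: a set of vertices of `G` and a set of edges
of `G` spanned by them. -/
structure Subgraph {t : ℕ} {V : Type*} (G : TGraph t V) where
  /-- the vertices of the subgraph -/
  verts : Finset V
  /-- the edges of the subgraph -/
  edges : Finset (Finset V)
  /-- the edges of the subgraph are edges of `G` -/
  edges_subset : edges ⊆ G.edges
  /-- the edges of the subgraph consist of vertices of the subgraph -/
  edge_subset_verts : ∀ T ∈ edges, T ⊆ verts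

/-- The subgraph `S` of `G` is isomorphic to the `t`-graph `H`: some bijection from the vertices
of `H` to those of `S` carries edges to edges and non-edges to non-edges. -/
def Subgraph.IsCopy {t : ℕ} {V X : Type*} {G : TGraph t V} (S : G.Subgraph)
    (H : TGraph t X) : Prop :=
  ∃ e : X ≃ {x : V // x ∈ S.verts}, ∀ T : Finset X,
    T ∈ H.edges ↔ T.map (e.toEmbedding.trans (Function.Embedding.subtype _)) ∈ S.edges

/-- `G` has a rational decomposition into copies of `H`: there is a finite set of pairs
`(H_i, w_i)`, each consisting of a subgraph of `G` isomorphic to `H` and a positive rational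
weight, such that for every edge of `G` the weights of the `H_i` having it as an edge sum
to `1`. -/
def HasRationalDecomposition {t : ℕ} {V X : Type*} [DecidableEq V]
    (G : TGraph t V) (H : TGraph t X) : Prop :=
  ∃ D : Finset (G.Subgraph × ℚ),
    (∀ p ∈ D, p.1.IsCopy H ∧ 0 < p.2) ∧
      ∀ T ∈ G.edges, ∑ p ∈ D with T ∈ p.1.edges, p.2 = 1

end TGraph

/-! Give every $k$-clique of $G$ the weight $1/P$, where $P=\binom{v-t}{k-t}$ counts the $k$-sets
through a fixed $t$-set. An edge $e$ then receives $1-c(e)$, where $c(e)$ is the fraction of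
$k$-sets through $e$ that are not cliques. Deficits are repaired locally. Inside a $(k+t)$-clique
$J\supseteq e$, the signed weights `switchWeight` on the $k$-subsets $K$ of $J$ depend only on
$|K\cap e|$; they add $1$ to $e$ and $0$ to every other $t$-subset (`sum_switchWeight`). Spread
$c(e)$ evenly over the $N(e)$ such cliques $J$. The total change at $K$ is at most $1/P$, so the
weights stay nonnegative: for each $J\supseteq K$ the gadgets contribute at most $2^t\max_e
c(e)/N(e)$ (`sum_abs_switchWeight_le`). Density bounds $c(e)$ by $2\epsilon k^t$
(`IsDense.card_nonclique_le`), while the gadgets tolerate deficits of order $\binom kt^{-1}$; hence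
the threshold $k^{-2t}$. For general $H$, the weight of each clique is averaged over all placements
of $H$ on it. -/

/-! ### Sums over subsets of a fixed size. -/

open Finset in
theorem sum_powersetCard_union {α : Type*} [DecidableEq α] {A B : Finset α}
    (hAB : Disjoint A B) (n : ℕ) (f : ℕ → ℚ) :
    ∑ S ∈ powersetCard n (A ∪ B), f (S ∩ A).card =
      ∑ j ∈ range (n + 1), ((A.card.choose j * B.card.choose (n - j) : ℕ) : ℚ) * f j := by
  rw [← sum_fiberwise_of_maps_to (g := fun S => (S ∩ A).card) (t := range (n + 1))]
  · refine sum_congr rfl fun j hj => ?_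
    rw [sum_congr rfl (g := fun _ => f j) (fun S hS => by rw [(mem_filter.1 hS).2]),
      sum_const, nsmul_eq_mul]
    congr 2
    rw [← card_powersetCard, ← card_powersetCard, ← card_product]
    have hj' : j ≤ n := by simpa [Nat.lt_succ_iff] using hj
    refine card_nbij' (fun S => (S ∩ A, S ∩ B)) (fun p => p.1 ∪ p.2) ?_ ?_ ?_ ?_
    · intro S hS
      simp only [coe_filter, mem_powersetCard, Set.mem_ofPred_eq] at hS
      obtain ⟨⟨h1, h2⟩, h3⟩ := hS
      simp only [coe_product, Set.mem_prod, mem_coe, mem_powersetCard]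
      refine ⟨⟨inter_subset_right, h3⟩, inter_subset_right, ?_⟩
      have : (S ∩ A).card + (S ∩ B).card = S.card := by
        rw [← card_union_of_disjoint (hAB.mono inter_subset_right inter_subset_right),
          ← inter_union_distrib_left, inter_eq_left.2 h1]
      omega
    · rintro ⟨P, Q⟩ h
      simp only [coe_product, Set.mem_prod, mem_coe, mem_powersetCard] at h
      obtain ⟨⟨h1, h2⟩, h3, h4⟩ := h
      simp only [coe_filter, mem_powersetCard, Set.mem_ofPred_eq]
      refine ⟨⟨union_subset_union h1 h3, ?_⟩, ?_⟩
      · rw [card_union_of_disjoint (hAB.mono h1 h3)]; omega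
      · rw [union_inter_distrib_right, inter_eq_left.2 h1,
          disjoint_iff_inter_eq_empty.1 (hAB.symm.mono_left h3), union_empty, h2]
    · intro S hS
      simp only [coe_filter, mem_powersetCard, Set.mem_ofPred_eq] at hS
      change S ∩ A ∪ S ∩ B = S
      rw [← inter_union_distrib_left, inter_eq_left.2 hS.1.1]
    · rintro ⟨P, Q⟩ h
      simp only [coe_product, Set.mem_prod, mem_coe, mem_powersetCard] at h
      obtain ⟨⟨h1, h2⟩, h3, h4⟩ := h
      simp only [Prod.mk.injEq]
      constructor
      · rw [union_inter_distrib_right, inter_eq_left.2 h1,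
          disjoint_iff_inter_eq_empty.1 (hAB.symm.mono_left h3), union_empty]
      · rw [union_inter_distrib_right, inter_eq_left.2 h3,
          disjoint_iff_inter_eq_empty.1 (hAB.mono_left h1), empty_union]
  · intro S hS
    have := card_le_card (inter_subset_left : S ∩ A ⊆ S)
    rw [(mem_powersetCard.1 hS).2] at this
    simpa [Nat.lt_succ_iff] using this

open Finset in
theorem sum_powersetCard_filter_superset {α : Type*} [DecidableEq α] {T J : Finset α}
    (hT : T ⊆ J) (m : ℕ) (f : Finset α → ℚ) :
    ∑ K ∈ powersetCard (T.card + m) J with T ⊆ K, f K =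
      ∑ S ∈ powersetCard m (J \ T), f (T ∪ S) := by
  refine sum_nbij' (fun K => K \ T) (fun S => T ∪ S) ?_ ?_ ?_ ?_ ?_
  · intro K hK
    simp only [mem_filter, mem_powersetCard] at hK ⊢
    refine ⟨sdiff_subset_sdiff hK.1.1 le_rfl, ?_⟩
    rw [card_sdiff_of_subset hK.2]; omega
  · intro S hS
    simp only [mem_filter, mem_powersetCard] at hS ⊢
    refine ⟨⟨union_subset hT (hS.1.trans sdiff_subset), ?_⟩, subset_union_left⟩
    rw [card_union_of_disjoint (disjoint_sdiff.mono_right hS.1), hS.2]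
  · intro K hK
    simp only [mem_filter] at hK
    exact union_sdiff_of_subset hK.2
  · intro S hS
    exact union_sdiff_cancel_left (disjoint_sdiff.mono_right (mem_powersetCard.1 hS).1)
  · intro K hK
    simp only [mem_filter] at hK
    rw [union_sdiff_of_subset hK.2]

open Finset in
theorem card_powersetCard_filter_superset {α : Type*} [DecidableEq α] {T J : Finset α}
    (hT : T ⊆ J) (m : ℕ) (p : Finset α → Prop) [DecidablePred p] :
    #{K ∈ powersetCard (T.card + m) J | T ⊆ K ∧ p K} =
      #{S ∈ powersetCard m (J \ T) | p (T ∪ S)} := by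
  have := sum_powersetCard_filter_superset hT m (fun K => if p K then 1 else 0)
  rw [← sum_filter, ← sum_filter, filter_filter] at this
  simpa using this

/-! ### The switching gadget. -/

-- This is an $s$-th finite difference of a polynomial in $p$ of degree $r<s$. The condition `s ≤ n`
-- keeps the natural subtraction `n - p` exact.
open Finset in
theorem sum_neg_one_pow_choose_mul_choose_sub (s n r : ℕ) (hr : r < s) (hn : s ≤ n) :
    ∑ p ∈ range (s + 1), (-1 : ℚ) ^ p * s.choose p * (n - p).choose r = 0 := by
  induction s generalizing n r with
  | zero => omega
  | succ s ih =>
    obtain ⟨n, rfl⟩ : ∃ m, n = m + 1 := ⟨n - 1, by omega⟩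
    have key : ∑ p ∈ range (s + 2), (-1 : ℚ) ^ p * (s + 1).choose p * (n + 1 - p).choose r =
        ∑ p ∈ range (s + 1), (-1 : ℚ) ^ p * s.choose p *
          (((n + 1 - p).choose r : ℚ) - (n - p).choose r) := by
      rw [sum_range_succ']
      simp only [Nat.choose_succ_succ' s, Nat.add_sub_add_right, pow_succ, Nat.cast_add]
      have h2 : ∑ p ∈ range (s + 1), (-1 : ℚ) ^ p * s.choose p * (n + 1 - p).choose r =
          ∑ p ∈ range (s + 1), (-1 : ℚ) ^ (p + 1) * s.choose (p + 1) * (n - p).choose r +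
            (n + 1).choose r := by
        have := sum_range_succ' (fun p => (-1 : ℚ) ^ p * s.choose p * (n + 1 - p).choose r) (s + 1)
        rw [sum_range_succ] at this
        simpa using this
      simp only [mul_sub, sum_sub_distrib]
      rw [h2]
      simp only [pow_succ, mul_add, add_mul, sum_add_distrib]
      simp only [mul_neg, mul_one, neg_mul, sum_neg_distrib]
      simp
      ring
    rw [key]
    cases r with
    | zero => simp
    | succ r =>
      rw [← ih n r (by omega) (by omega)]
      refine sum_congr rfl fun p hp => ?_
      have : p ≤ s := by simpa [Nat.lt_succ_iff] using hp
      rw [show n + 1 - p = (n - p) + 1 by omega, Nat.choose_succ_succ']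
      push_cast; ring

/-- The weight of a `k`-set meeting a fixed `t`-set in `j` points. -/
def switchWeight (t k j : ℕ) : ℚ :=
  (-1) ^ (t + j) * (((k : ℚ) - t) / ((k : ℚ) - j)) / k.choose j

theorem abs_switchWeight_le {t k j : ℕ} (htk : t < k) (hj : j ≤ t) :
    |switchWeight t k j| ≤ 1 / k.choose j := by
  unfold switchWeight
  rw [abs_div, abs_mul, abs_pow, abs_neg, abs_one, one_pow, one_mul, Nat.abs_cast]
  gcongr
  have h1 : (t : ℚ) < k := by exact_mod_cast htk
  have h2 : (j : ℚ) ≤ t := by exact_mod_cast hj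
  rw [abs_of_nonneg (by apply div_nonneg <;> linarith), div_le_one (by linarith)]
  linarith

/-- Here $a=k-t$, $i=|e\cap T|$, $s=|e\setminus T|$, and $p$ counts the further points of $e$ in
$K$. The factor $(k-t)/(k-j)$ in the weight lowers the degree in $p$ from $s$ to $s-1$, so that the
$s$-th difference vanishes. -/
theorem choose_mul_switchWeight {a i s p : ℕ} (ha : 0 < a) (hs : 0 < s) (hp : p ≤ s)
    (hpa : p ≤ a) :
    ((a + i).choose (a - p) : ℚ) * switchWeight (i + s) (a + (i + s)) (i + p) =
      (-1) ^ s * (a * (a + i).factorial * (s - 1).factorial / (a + (i + s)).factorial) *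
        ((-1) ^ p * (a + s - 1 - p).choose (s - 1)) := by
  obtain ⟨b, rfl⟩ := Nat.exists_eq_add_of_le hpa
  obtain ⟨s, rfl⟩ : ∃ m, s = m + 1 := ⟨s - 1, by omega⟩
  unfold switchWeight
  have h1 : ((p + b + i).choose (p + b - p) : ℚ) =
      (p + b + i).factorial / (b.factorial * (i + p).factorial) := by
    rw [show p + b - p = b by omega, show p + b + i = b + (i + p) by omega, Nat.cast_add_choose]
  have h2 : ((p + b + (i + (s + 1))).choose (i + p) : ℚ) =
      (p + b + (i + (s + 1))).factorial / ((i + p).factorial * (b + s + 1).factorial) := by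
    rw [show p + b + (i + (s + 1)) = (i + p) + (b + s + 1) by omega, Nat.cast_add_choose]
  have h3 : ((p + b + (s + 1) - 1 - p).choose (s + 1 - 1) : ℚ) =
      (b + s).factorial / (b.factorial * s.factorial) := by
    rw [show p + b + (s + 1) - 1 - p = s + b by omega, Nat.add_sub_cancel,
      Nat.cast_add_choose, add_comm s b, mul_comm]
  have h4 : ((p + b + (i + (s + 1)) : ℕ) : ℚ) - ((i + p : ℕ) : ℚ) = (b + s + 1 : ℕ) := by
    push_cast; ring
  have h5 : ((p + b + (i + (s + 1)) : ℕ) : ℚ) - ((i + (s + 1) : ℕ) : ℚ) = (p + b : ℕ) := by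
    push_cast; ring
  rw [h1, h2, h3, h4, h5, Nat.factorial_succ (b + s)]
  have h6 : (-1 : ℚ) ^ (i + (s + 1) + (i + p)) = (-1) ^ (s + 1) * (-1) ^ p := by
    rw [← pow_add, show i + (s + 1) + (i + p) = 2 * i + (s + 1 + p) by ring, pow_add, pow_mul]
    simp
  rw [h6]
  have e1 : ((p + b + (i + (s + 1))).factorial : ℚ) ≠ 0 := by exact_mod_cast Nat.factorial_ne_zero _
  have e2 : ((b + s).factorial : ℚ) ≠ 0 := by exact_mod_cast Nat.factorial_ne_zero _
  have e3 : ((s).factorial : ℚ) ≠ 0 := by exact_mod_cast Nat.factorial_ne_zero _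
  have e4 : ((b).factorial : ℚ) ≠ 0 := by exact_mod_cast Nat.factorial_ne_zero _
  have e5 : ((i + p).factorial : ℚ) ≠ 0 := by exact_mod_cast Nat.factorial_ne_zero _
  have e6 : ((b + s + 1 : ℕ) : ℚ) ≠ 0 := by exact_mod_cast Nat.succ_ne_zero (b + s)
  simp only [Nat.add_sub_cancel]
  generalize ((p + b + (i + (s + 1))).factorial : ℚ) = x1 at *
  generalize ((p + b + i).factorial : ℚ) = x2 at *
  generalize ((-1 : ℚ) ^ (s + 1)) = x3 at *
  generalize ((-1 : ℚ) ^ p) = x4 at *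
  push_cast at *
  field_simp

open Finset in
theorem sum_choose_mul_switchWeight {a i s : ℕ} (ha : 0 < a) :
    ∑ p ∈ range (a + 1), ((s.choose p * (a + i).choose (a - p) : ℕ) : ℚ) *
      switchWeight (i + s) (a + (i + s)) (i + p) = if s = 0 then 1 else 0 := by
  split_ifs with hs
  · subst hs
    rw [sum_eq_single 0]
    · have h : ((a + i).choose i : ℚ) ≠ 0 := by
        exact_mod_cast (Nat.choose_pos (Nat.le_add_left i a)).ne'
      have ha' : (a : ℚ) ≠ 0 := by exact_mod_cast ha.ne'
      have : (-1 : ℚ) ^ (i + i) = 1 := by rw [← two_mul, pow_mul]; simp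
      have h' : ((a + i).choose a : ℚ) = (a + i).choose i := by
        rw [Nat.choose_symm_add]
      simp [switchWeight, this, h', ha', h]
    · intro p _ hp
      rw [Nat.choose_eq_zero_of_lt (by omega)]; simp
    · simp
  · set c : ℚ := (-1) ^ s * (a * (a + i).factorial * (s - 1).factorial / (a + (i + s)).factorial)
    have h0 := sum_neg_one_pow_choose_mul_choose_sub s (a + s - 1) (s - 1) (by omega) (by omega)
    -- The range up to $a+s$ contains both the natural range $p\le s$ of the difference and the
    -- range $p\le a$ of the goal; all extra terms vanish.
    have h1 : ∑ p ∈ range (a + s + 1), c * ((-1 : ℚ) ^ p * s.choose p *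
        (a + s - 1 - p).choose (s - 1)) = 0 := by
      rw [← mul_sum, ← sum_subset (range_mono (show s + 1 ≤ a + s + 1 by omega)), h0, mul_zero]
      intro p _ hp
      rw [Nat.choose_eq_zero_of_lt (n := s) (by simpa [Nat.lt_succ_iff] using hp)]; simp
    rw [← h1, ← sum_subset (range_mono (show a + 1 ≤ a + s + 1 by omega))]
    · refine sum_congr rfl fun p hp => ?_
      have hpa : p ≤ a := by simpa [Nat.lt_succ_iff] using hp
      by_cases hp : p ≤ s
      · have := choose_mul_switchWeight (i := i) ha (by omega) hp hpa
        push_cast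
        rw [mul_assoc, this]
        ring
      · rw [Nat.choose_eq_zero_of_lt (n := s) (by omega)]; simp
    · intro p _ hp
      have : a < p := by simpa [Nat.lt_succ_iff] using hp
      by_cases hps : p ≤ s
      · rw [Nat.choose_eq_zero_of_lt (n := a + s - 1 - p) (by omega)]; simp
      · rw [Nat.choose_eq_zero_of_lt (n := s) (by omega)]; simp

open Finset in
/-- The weighting `switchWeight` of the `k`-subsets of a `(k + t)`-set puts weight `1` on a fixed
`t`-set and weight `0` on all others. -/
theorem sum_switchWeight {α : Type*} [DecidableEq α] {t k : ℕ} (htk : t < k)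
    {J e T : Finset α} (hJ : J.card = k + t) (he : e ⊆ J) (hT : T ⊆ J) (he' : e.card = t)
    (hT' : T.card = t) :
    ∑ K ∈ powersetCard k J with T ⊆ K, switchWeight t k (K ∩ e).card = if T = e then 1 else 0 := by
  obtain ⟨a, rfl⟩ := Nat.exists_eq_add_of_lt htk
  have h := sum_powersetCard_filter_superset hT (a + 1)
    (fun K => switchWeight t (t + a + 1) (K ∩ e).card)
  rw [hT', ← add_assoc] at h
  rw [h]
  -- For $K=T\cup S$ the weight sees $S$ only through $|S\cap(e\setminus T)|$, hence this splitting.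
  have hJT : J \ T = (e \ T) ∪ (J \ (e ∪ T)) := by
    ext x; simp only [mem_sdiff, mem_union]
    have := @he x
    tauto
  have hdis : Disjoint (e \ T) (J \ (e ∪ T)) :=
    disjoint_sdiff.mono_left (sdiff_subset.trans subset_union_left)
  have hcard : (e ∩ T).card + (e \ T).card = t := by rw [card_inter_add_card_sdiff, he']
  have hrest : (J \ (e ∪ T)).card = a + 1 + (e ∩ T).card := by
    rw [card_sdiff_of_subset (union_subset he hT)]
    have := card_union_add_card_inter e T
    omega
  have hterm : ∀ S ∈ powersetCard (a + 1) (J \ T),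
      switchWeight t (t + a + 1) ((T ∪ S) ∩ e).card =
        switchWeight t (t + a + 1) ((e ∩ T).card + (S ∩ (e \ T)).card) := by
    intro S hS
    have hS := (mem_powersetCard.1 hS).1
    congr 1
    rw [← card_union_of_disjoint]
    · congr 1
      ext x
      have := @hS x
      simp only [mem_sdiff, mem_union, mem_inter] at this ⊢
      tauto
    · exact (disjoint_sdiff (s := T) (t := e)).mono inter_subset_right inter_subset_right
  rw [sum_congr rfl hterm, hJT, sum_powersetCard_union hdis (a + 1)
    (fun j => switchWeight t (t + a + 1) ((e ∩ T).card + j)), hrest]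
  have := sum_choose_mul_switchWeight (a := a + 1) (i := (e ∩ T).card) (s := (e \ T).card)
    (by omega)
  rw [hcard, show a + 1 + t = t + a + 1 by omega] at this
  rw [this]
  congr 1
  rw [card_eq_zero, sdiff_eq_empty_iff_subset]
  refine propext ⟨fun h => (eq_of_subset_of_card_le h (by omega)).symm, fun h => h ▸ le_rfl⟩

-- There are $\binom kj\binom t{t-j}$ choices of $e$ meeting $K$ in $j$ points, each of weight at
-- most $1/\binom kj$; the factor $\binom kj$ cancels and $\sum_j\binom tj$ remains.
open Finset in
theorem sum_abs_switchWeight_le {α : Type*} [DecidableEq α] {t k : ℕ} (htk : t < k)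
    {J K : Finset α} (hJ : J.card = k + t) (hK : K ⊆ J) (hK' : K.card = k) :
    ∑ e ∈ powersetCard t J, |switchWeight t k (K ∩ e).card| ≤ 2 ^ t := by
  have hu : J = K ∪ (J \ K) := (union_sdiff_of_subset hK).symm
  have hc : (J \ K).card = t := by rw [card_sdiff_of_subset hK]; omega
  rw [hu]
  simp_rw [inter_comm K]
  rw [sum_powersetCard_union disjoint_sdiff t (fun j => |switchWeight t k j|), hK', hc]
  have : (2 : ℚ) ^ t = ∑ j ∈ range (t + 1), (t.choose j : ℚ) := by
    exact_mod_cast (Nat.sum_range_choose t).symm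
  rw [this]
  refine sum_le_sum fun j hj => ?_
  have hj : j ≤ t := by simpa [Nat.lt_succ_iff] using hj
  have hpos : (0 : ℚ) < k.choose j := by exact_mod_cast Nat.choose_pos (by omega)
  calc _ ≤ ((k.choose j * t.choose (t - j) : ℕ) : ℚ) * (1 / k.choose j) := by
        gcongr; exact abs_switchWeight_le htk hj
    _ = _ := by rw [Nat.choose_symm hj]; push_cast; field_simp

/-! ### Counting non-clique extensions of an edge. -/

namespace TGraph

/-- All `t`-subsets of `S` are edges of `G`. -/
abbrev IsClique {t : ℕ} {V : Type*} (G : TGraph t V) (S : Finset V) : Prop :=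
  Finset.powersetCard t S ⊆ G.edges

open Finset in
theorem IsClique.mono {t : ℕ} {V : Type*} {G : TGraph t V} {S S' : Finset V}
    (h : G.IsClique S) (hS : S' ⊆ S) : G.IsClique S' :=
  (powersetCard_mono hS).trans h

open Finset in
theorem degree_eq_card_filter_insert {t : ℕ} {V : Type*} [Fintype V] [DecidableEq V]
    (G : TGraph t V) {U : Finset V} (hU : U.card + 1 = t) :
    G.degree U = #{x | x ∉ U ∧ insert x U ∈ G.edges} := by
  unfold degree
  rw [← card_image_of_injOn (s := {x | x ∉ U ∧ insert x U ∈ G.edges}) (f := fun x => insert x U)]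
  · congr 1
    ext T
    simp only [mem_filter, mem_image, mem_univ, true_and]
    constructor
    · rintro ⟨hT, hUT⟩
      obtain ⟨x, hx, rfl⟩ := exists_eq_insert_iff.2 ⟨hUT, by rw [G.card_edge T hT, hU]⟩
      exact ⟨x, ⟨hx, hT⟩, rfl⟩
    · rintro ⟨x, ⟨hx, hT⟩, rfl⟩
      exact ⟨hT, subset_insert _ _⟩
  · intro x hx y hy h
    simp only [coe_filter, mem_univ, true_and, Set.mem_ofPred_eq] at hx hy
    exact (insert_inj hx.1).1 h

open Finset in
theorem minDegree_le_degree {t : ℕ} {V : Type*} [DecidableEq V] (G : TGraph t V) (U : Finset V) :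
    G.minDegree U.card ≤ G.degree U :=
  Nat.sInf_le ⟨U, rfl, rfl⟩

open Finset in
theorem degree_add_card_nonextensions {t : ℕ} {V : Type*} [Fintype V] [DecidableEq V]
    (G : TGraph t V) {U : Finset V} (hU : U.card + 1 = t) :
    G.degree U + #{x | x ∉ U ∧ insert x U ∉ G.edges} = Fintype.card V - (t - 1) := by
  rw [degree_eq_card_filter_insert G hU, ← filter_filter, ← filter_filter,
    card_filter_add_card_filter_not, filter_not, filter_mem_eq_inter, univ_inter,
    card_univ_sdiff]
  congr 1; omega

open Finset in
/-- If every `(t-1)`-set has at most `d` non-extensions, few `(n+1)`-sets extend a given edge to a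
non-clique. -/
theorem card_nonclique_le {t : ℕ} (ht1 : 1 ≤ t) {V : Type*} [Fintype V] [DecidableEq V] (G : TGraph t V)
    {d : ℕ} (hd : ∀ U : Finset V, U.card + 1 = t → #{x | x ∉ U ∧ insert x U ∉ G.edges} ≤ d)
    {e : Finset V} (he : e ∈ G.edges) (n : ℕ) :
    #{S ∈ powersetCard (n + 1) (univ \ e) | ¬ G.IsClique (e ∪ S)} ≤
      (Fintype.card V - t).choose n * ((t + n).choose (t - 1) * d) := by
  -- A missing $t$-set $T\subseteq e\cup S$ is not inside $e$, so it has a point $x\in S$. Then $S$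
  -- is determined by $S'=S\setminus\{x\}$ and $x$, where $x$ is a non-extension of
  -- $U=T\setminus\{x\}\subseteq e\cup S'$.
  have hsub : {S ∈ powersetCard (n + 1) (univ \ e) | ¬ G.IsClique (e ∪ S)} ⊆
      (powersetCard n (univ \ e)).biUnion fun S' =>
        (powersetCard (t - 1) (e ∪ S')).biUnion fun U =>
          ({x | x ∉ U ∧ insert x U ∉ G.edges} : Finset V).image fun x => insert x S' := by
    intro S hS
    simp only [mem_filter, mem_powersetCard] at hS
    obtain ⟨⟨hS1, hS2⟩, hS3⟩ := hS
    obtain ⟨T, hT, hTG⟩ := not_subset.1 hS3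
    rw [mem_powersetCard] at hT
    have hTe : ¬ T ⊆ e := fun h =>
      hTG (by rwa [eq_of_subset_of_card_le h (by rw [hT.2, G.card_edge e he])])
    obtain ⟨x, hxT, hxe⟩ := not_subset.1 hTe
    have hxS : x ∈ S := (mem_union.1 (hT.1 hxT)).resolve_left hxe
    simp only [mem_biUnion, mem_image, mem_powersetCard, mem_filter, mem_univ, true_and]
    refine ⟨S.erase x, ⟨(erase_subset _ _).trans hS1, ?_⟩, T.erase x, ⟨?_, ?_⟩, x, ⟨?_, ?_⟩, ?_⟩
    · rw [card_erase_of_mem hxS]; omega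
    · intro y hy
      rw [mem_erase] at hy
      have := hT.1 hy.2
      rw [mem_union] at this ⊢
      exact this.imp_right fun h => mem_erase.2 ⟨hy.1, h⟩
    · rw [card_erase_of_mem hxT, hT.2]
    · exact notMem_erase _ _
    · rwa [insert_erase hxT]
    · exact insert_erase hxS
  have ht : e.card = t := G.card_edge e he
  refine (card_le_card hsub).trans ?_
  refine (card_biUnion_le_card_mul _ _ ((t + n).choose (t - 1) * d) fun S' hS' => ?_).trans ?_
  · rw [mem_powersetCard] at hS'
    have hc : (e ∪ S').card = t + n := by
      rw [card_union_of_disjoint (disjoint_sdiff.mono_right hS'.1), ht, hS'.2]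
    refine (card_biUnion_le_card_mul _ _ d fun U hU => ?_).trans ?_
    · rw [mem_powersetCard] at hU
      exact card_image_le.trans (hd U (by omega))
    · rw [card_powersetCard, hc]
  · rw [card_powersetCard, card_univ_sdiff, ht]

open Finset in
theorem IsDense.card_nonclique_le {t : ℕ} (ht : 1 ≤ t) {V : Type*} [Fintype V] [DecidableEq V]
    {G : TGraph t V} {ε : ℝ} (hG : G.IsDense ε) {e : Finset V} (he : e ∈ G.edges) (m : ℕ)
    (hv : t + 2 * m ≤ Fintype.card V) :
    0 ≤ ε ∧
    (#{S ∈ powersetCard m (univ \ e) | ¬ G.IsClique (e ∪ S)} : ℝ) ≤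
      2 * ε * (t + m : ℕ) ^ t * (Fintype.card V - t).choose m := by
  have htV : t ≤ Fintype.card V := by omega
  have hmin : G.minDegree (t - 1) ≤ Fintype.card V - (t - 1) := by
    obtain ⟨U, hU⟩ : ∃ U : Finset V, U.card = t - 1 := by
      obtain ⟨U, -, hU⟩ := exists_subset_card_eq (s := (univ : Finset V)) (n := t - 1)
        (by rw [card_univ]; omega)
      exact ⟨U, hU⟩
    have h1 := G.minDegree_le_degree U
    have h2 := G.degree_add_card_nonextensions (U := U) (by omega)
    rw [hU] at h1; omega
  -- The largest possible number of non-extensions of a $(t-1)$-set; `hmin` makes the truncated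
  -- subtraction exact.
  set d := Fintype.card V - (t - 1) - G.minDegree (t - 1) with hd_def
  have hd : ∀ U : Finset V, U.card + 1 = t → #{x | x ∉ U ∧ insert x U ∉ G.edges} ≤ d := by
    intro U hU
    have h1 := G.minDegree_le_degree U
    have h2 := G.degree_add_card_nonextensions hU
    rw [show U.card = t - 1 by omega] at h1
    omega
  have hdε : (d : ℝ) ≤ ε * ((Fintype.card V : ℝ) - t + 1) := by
    have h := hG
    unfold IsDense at h
    have hsum : G.minDegree (t - 1) + d + t = Fintype.card V + 1 := by omega
    have hsum' : (G.minDegree (t - 1) : ℝ) + d + t = Fintype.card V + 1 := by exact_mod_cast hsum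
    linarith
  have hvt : (0 : ℝ) < (Fintype.card V : ℝ) - t + 1 := by
    have : (t : ℝ) ≤ Fintype.card V := by exact_mod_cast htV
    linarith
  have hε : 0 ≤ ε := nonneg_of_mul_nonneg_left ((Nat.cast_nonneg d).trans hdε) hvt
  refine ⟨hε, ?_⟩
  cases m with
  | zero =>
    have : {S ∈ powersetCard 0 (univ \ e) | ¬ G.IsClique (e ∪ S)} = ∅ := by
      refine filter_eq_empty_iff.2 fun S hS => ?_
      rw [powersetCard_zero, mem_singleton] at hS
      subst hS
      rw [not_not, union_empty]
      intro T hT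
      rw [mem_powersetCard] at hT
      rwa [eq_of_subset_of_card_le hT.1 (by rw [hT.2, G.card_edge e he])]
    rw [this]; simp; positivity
  | succ n =>
    have hb := G.card_nonclique_le ht hd he n
    set b := #{S ∈ powersetCard (n + 1) (univ \ e) | ¬ G.IsClique (e ∪ S)}
    set r := Fintype.card V - t - n with hr
    have hrpos : 0 < r := by omega
    have hpow : (n + 1) * (t + n).choose (t - 1) ≤ (t + (n + 1)) ^ t := by
      obtain ⟨s, rfl⟩ : ∃ s, t = s + 1 := ⟨t - 1, by omega⟩
      rw [pow_succ', Nat.add_sub_cancel]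
      exact Nat.mul_le_mul (by omega) ((Nat.choose_le_pow _ _).trans
        (Nat.pow_le_pow_left (by omega) _))
    -- Multiplying by $r=v-t-n$ turns $\binom{v-t}n$ into $(n+1)\binom{v-t}{n+1}$. Since $v-t+1\le
    -- 2r$ by `hv`, dividing by $r$ later costs only a factor $2$.
    have h1 : b * r ≤ (t + (n + 1)) ^ t * (Fintype.card V - t).choose (n + 1) * d := by
      calc b * r ≤ (Fintype.card V - t).choose n * ((t + n).choose (t - 1) * d) * r := by gcongr
        _ = ((Fintype.card V - t).choose n * r) * ((t + n).choose (t - 1) * d) := by ring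
        _ = ((n + 1) * (t + n).choose (t - 1)) * (Fintype.card V - t).choose (n + 1) * d := by
            rw [hr, ← Nat.choose_succ_right_eq]; ring
        _ ≤ _ := by gcongr
    have h1' : (b : ℝ) * r ≤
        ((t + (n + 1) : ℕ) : ℝ) ^ t * (Fintype.card V - t).choose (n + 1) * d := by
      exact_mod_cast h1
    have h2 : (d : ℝ) ≤ 2 * ε * r := by
      have : (Fintype.card V : ℝ) - t + 1 ≤ 2 * r := by
        have : Fintype.card V + 1 ≤ 2 * r + t := by omega
        have : (Fintype.card V : ℝ) + 1 ≤ 2 * r + t := by exact_mod_cast this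
        linarith
      nlinarith
    refine le_of_mul_le_mul_right (h1'.trans ?_) (show (0 : ℝ) < r by exact_mod_cast hrpos)
    calc _ ≤ ((t + (n + 1) : ℕ) : ℝ) ^ t * (Fintype.card V - t).choose (n + 1) * (2 * ε * r) := by
          gcongr
      _ = _ := by ring

end TGraph

/-! ### Correcting the uniform weighting of cliques. -/

namespace TGraph

open Finset in
theorem card_cliques_add_card_nonclique {t : ℕ} {V : Type*} [Fintype V] [DecidableEq V]
    (G : TGraph t V) {e : Finset V} (he : e ∈ G.edges) (m : ℕ) :
    #{K ∈ powersetCard (t + m) univ | e ⊆ K ∧ G.IsClique K} +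
      #{S ∈ powersetCard m (univ \ e) | ¬ G.IsClique (e ∪ S)} =
        (Fintype.card V - t).choose m := by
  have h := card_powersetCard_filter_superset (subset_univ e) m G.IsClique
  rw [G.card_edge e he] at h
  rw [h, card_filter_add_card_filter_not, card_powersetCard, card_univ_sdiff, G.card_edge e he]

open Finset in
theorem card_powersetCard_univ_superset {V : Type*} [Fintype V] [DecidableEq V]
    (K : Finset V) (m : ℕ) :
    #{J ∈ powersetCard (K.card + m) univ | K ⊆ J} = (Fintype.card V - K.card).choose m := by
  have h := card_powersetCard_filter_superset (subset_univ K) m (fun _ => True)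
  simp only [and_true, filter_true] at h
  rw [h, card_powersetCard, card_univ_sdiff]

open Finset in
theorem sum_switchWeight_cliques {t k : ℕ} (htk : t < k) {V : Type*} [Fintype V] [DecidableEq V]
    {G : TGraph t V} {J e T : Finset V} (hJ : J.card = k + t) (hJG : G.IsClique J)
    (he : e ∈ G.edges) (heJ : e ⊆ J) (hT : T ∈ G.edges) :
    ∑ K ∈ powersetCard k univ with G.IsClique K ∧ T ⊆ K,
      (if K ⊆ J then switchWeight t k (K ∩ e).card else 0) = if T = e then 1 else 0 := by
  rw [← sum_filter, filter_filter]
  by_cases hTJ : T ⊆ J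
  · rw [← sum_switchWeight htk hJ heJ hTJ (G.card_edge e he) (G.card_edge T hT)]
    refine sum_congr ?_ fun _ _ => rfl
    ext K
    simp only [mem_filter, mem_powersetCard, subset_univ, true_and]
    exact ⟨fun h => ⟨⟨h.2.2, h.1⟩, h.2.1.2⟩, fun h => ⟨h.1.2, ⟨hJG.mono h.1.1, h.2⟩, h.1.1⟩⟩
  · rw [if_neg (by rintro rfl; exact hTJ heJ), sum_eq_zero]
    intro K hK
    simp only [mem_filter] at hK
    exact absurd (hK.2.1.2.trans hK.2.2) hTJ

-- `h1` makes every deficit at most $1/(2^{t+1}\binom kt)$; `h2` makes at least half of the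
-- $(k+t)$-sets through each edge cliques, so each deficit can be spread thinly.
open Finset in
theorem exists_clique_weights {t k : ℕ} (htk : t < k) {V : Type*} [Fintype V] [DecidableEq V]
    (G : TGraph t V) (hv : k + t ≤ Fintype.card V)
    (h1 : ∀ e ∈ G.edges,
      #{S ∈ powersetCard (k - t) (univ \ e) | ¬ G.IsClique (e ∪ S)} * (2 ^ (t + 1) * k.choose t) ≤
        (Fintype.card V - t).choose (k - t))
    (h2 : ∀ e ∈ G.edges,
      2 * #{S ∈ powersetCard k (univ \ e) | ¬ G.IsClique (e ∪ S)} ≤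
        (Fintype.card V - t).choose k) :
    ∃ w : Finset V → ℚ, (∀ K, K.card = k → 0 ≤ w K) ∧ ∀ T ∈ G.edges,
      ∑ K ∈ powersetCard k univ with G.IsClique K ∧ T ⊆ K, w K = 1 := by
  set P := (Fintype.card V - t).choose (k - t) with hP
  set M := (Fintype.card V - t).choose k with hM
  have hPpos : 0 < P := Nat.choose_pos (by omega)
  have hMpos : 0 < M := Nat.choose_pos (by omega)
  set κ : Finset V → ℕ := fun e => #{K ∈ powersetCard k univ | e ⊆ K ∧ G.IsClique K} with hκ
  set N : Finset V → ℕ := fun e => #{J ∈ powersetCard (k + t) univ | G.IsClique J ∧ e ⊆ J} with hN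
  have hκb : ∀ e ∈ G.edges, κ e +
      #{S ∈ powersetCard (k - t) (univ \ e) | ¬ G.IsClique (e ∪ S)} = P := by
    intro e he
    have := G.card_cliques_add_card_nonclique he (k - t)
    rwa [show t + (k - t) = k by omega] at this
  have hNb : ∀ e ∈ G.edges, N e +
      #{S ∈ powersetCard k (univ \ e) | ¬ G.IsClique (e ∪ S)} = M := by
    intro e he
    have := G.card_cliques_add_card_nonclique he k
    simp only [and_comm (a := e ⊆ _), add_comm t k] at this
    exact this
  have hN2 : ∀ e ∈ G.edges, M ≤ 2 * N e := fun e he => by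
    have := hNb e he
    have := h2 e he
    omega
  set c : Finset V → ℚ := fun e => 1 - κ e / P with hc
  have hP' : (0 : ℚ) < P := by exact_mod_cast hPpos
  have hM' : (0 : ℚ) < M := by exact_mod_cast hMpos
  have hkt : (0 : ℚ) < k.choose t := by exact_mod_cast Nat.choose_pos htk.le
  -- The quotient of the deficit bound from `h1` by $M/2\le N(e)$.
  set β : ℚ := 1 / (2 ^ t * k.choose t * M) with hβ
  have hcN : ∀ e ∈ G.edges, 0 ≤ c e / N e ∧ c e / N e ≤ β := by
    intro e he
    have h3 := h1 e he
    have h4 := hκb e he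
    have h5 := hN2 e he
    set b := #{S ∈ powersetCard (k - t) (univ \ e) | ¬ G.IsClique (e ∪ S)}
    have h3' : (b : ℚ) * (2 ^ (t + 1) * k.choose t) ≤ P := by exact_mod_cast h3
    have h4' : (κ e : ℚ) + b = P := by exact_mod_cast h4
    have h5' : (M : ℚ) ≤ 2 * N e := by exact_mod_cast h5
    have hce : c e = b / P := by
      rw [hc]; field_simp; linarith
    have hNpos : (0 : ℚ) < N e := by linarith
    refine ⟨by rw [hce]; positivity, ?_⟩
    rw [hce, hβ, div_div, div_le_div_iff₀ (by positivity) (by positivity)]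
    calc (b : ℚ) * (2 ^ t * k.choose t * M) ≤ b * (2 ^ t * k.choose t * (2 * N e)) := by gcongr
      _ = (b * (2 ^ (t + 1) * k.choose t)) * N e := by ring
      _ ≤ 1 * (P * N e) := by rw [one_mul]; gcongr
  refine ⟨fun K => 1 / P + ∑ e ∈ G.edges, ∑ J ∈ powersetCard (k + t) univ with
      G.IsClique J ∧ e ⊆ J, c e / N e * (if K ⊆ J then switchWeight t k (K ∩ e).card else 0),
    ?_, ?_⟩
  · intro K hK
    have habs : |∑ e ∈ G.edges, ∑ J ∈ powersetCard (k + t) univ with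
        G.IsClique J ∧ e ⊆ J, c e / N e * (if K ⊆ J then switchWeight t k (K ∩ e).card else 0)|
        ≤ 1 / P := by
      calc _ ≤ ∑ e ∈ G.edges, ∑ J ∈ powersetCard (k + t) univ with
            G.IsClique J ∧ e ⊆ J, β * (if K ⊆ J then |switchWeight t k (K ∩ e).card| else 0) := by
            refine (abs_sum_le_sum_abs _ _).trans (sum_le_sum fun e he => ?_)
            refine (abs_sum_le_sum_abs _ _).trans (sum_le_sum fun J _ => ?_)
            rw [abs_mul, abs_of_nonneg (hcN e he).1, apply_ite abs, abs_zero]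
            refine mul_le_mul_of_nonneg_right (hcN e he).2 ?_
            split_ifs <;> positivity
        _ ≤ β * ∑ J ∈ powersetCard (k + t) univ with K ⊆ J,
              ∑ e ∈ powersetCard t J, |switchWeight t k (K ∩ e).card| := by
            simp_rw [← mul_sum]
            refine mul_le_mul_of_nonneg_left ?_ (by positivity)
            rw [sum_filter]
            simp_rw [sum_filter]
            -- The gadgets affecting $K$ are regrouped by $J\supseteq K$; the bound then admits all
            -- such $J$ and all $t$-subsets of $J$.
            rw [sum_comm]
            refine sum_le_sum fun J _ => ?_
            split_ifs with hKJ
            · rw [← sum_filter]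
              refine sum_le_sum_of_subset_of_nonneg ?_ fun _ _ _ => abs_nonneg _
              intro e he
              rw [mem_filter] at he
              exact mem_powersetCard.2 ⟨he.2.2, G.card_edge e he.1⟩
            · simp
        _ ≤ β * ((Fintype.card V - k).choose t * 2 ^ t) := by
            refine mul_le_mul_of_nonneg_left ?_ (by positivity)
            rw [← hK, ← card_powersetCard_univ_superset K t, ← nsmul_eq_mul]
            refine sum_le_card_nsmul _ _ _ fun J hJ => ?_
            rw [mem_filter, mem_powersetCard] at hJ
            rw [hK] at hJ ⊢
            exact sum_abs_switchWeight_le htk hJ.1.2 hJ.2 hK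
        _ = 1 / P := by
            -- Double counting of $(k-t)$-subsets of $k$-subsets of a $(v-t)$-set; this makes the
            -- bound come out as exactly $1/P$.
            have hch : M * k.choose t = P * (Fintype.card V - k).choose t := by
              have := Nat.choose_mul (n := Fintype.card V - t) (k := k) (s := k - t)
                (by omega)
              rw [Nat.choose_symm htk.le] at this
              rw [hM, this, hP]
              congr 2 <;> omega
            have hch' : (M : ℚ) * k.choose t = P * (Fintype.card V - k).choose t := by
              exact_mod_cast hch
            rw [hβ]
            field_simp
            linarith
    have := neg_le_of_abs_le habs
    linarith
  · intro T hT
    have hκT : #{K ∈ powersetCard k univ | G.IsClique K ∧ T ⊆ K} = κ T := by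
      simp only [hκ, and_comm]
    rw [sum_add_distrib, sum_const, nsmul_eq_mul, hκT, sum_comm]
    have : ∀ e ∈ G.edges, ∑ K ∈ powersetCard k univ with G.IsClique K ∧ T ⊆ K,
        ∑ J ∈ powersetCard (k + t) univ with G.IsClique J ∧ e ⊆ J,
          c e / N e * (if K ⊆ J then switchWeight t k (K ∩ e).card else 0) =
        if T = e then c e else 0 := by
      intro e he
      rw [sum_comm]
      have hNe : (N e : ℚ) ≠ 0 := by
        have := hN2 e he
        have : 0 < N e := by omega
        exact_mod_cast this.ne'
      rw [sum_congr rfl (g := fun _ => c e / N e * (if T = e then 1 else 0)), sum_const,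
        nsmul_eq_mul]
      · change (N e : ℚ) * _ = _
        split_ifs
        · field_simp
        · simp
      · intro J hJ
        rw [mem_filter, mem_powersetCard] at hJ
        rw [← mul_sum, sum_switchWeight_cliques htk hJ.1.2 hJ.2.1 he hJ.2.2 hT]
    rw [sum_congr rfl this, sum_ite_eq, if_pos hT, hc]
    ring

/-! ### From clique weights to decompositions into copies of $H$. -/

-- Different indices may give the same subgraph, and a decomposition needs positive weights: weights
-- are added up along the fibres of `s` and zero totals are dropped.
open Finset in
theorem hasRationalDecomposition_of_weights {t : ℕ} {V X ι : Type*} [DecidableEq V]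
    {G : TGraph t V} {H : TGraph t X} (I : Finset ι) (s : ι → G.Subgraph) (w : ι → ℚ)
    (hs : ∀ i ∈ I, (s i).IsCopy H) (hw : ∀ i ∈ I, 0 ≤ w i)
    (h : ∀ T ∈ G.edges, ∑ i ∈ I with T ∈ (s i).edges, w i = 1) :
    G.HasRationalDecomposition H := by
  classical
  set W : G.Subgraph → ℚ := fun S => ∑ i ∈ I with s i = S, w i with hW
  have hW0 : ∀ S, 0 ≤ W S := fun S => sum_nonneg fun i hi => hw i (mem_filter.1 hi).1
  refine ⟨((I.image s).filter (fun S => W S ≠ 0)).image fun S => (S, W S), ?_, ?_⟩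
  · intro p hp
    simp only [mem_image, mem_filter] at hp
    obtain ⟨_, ⟨⟨i, hi, rfl⟩, hS⟩, rfl⟩ := hp
    exact ⟨hs i hi, lt_of_le_of_ne (hW0 _) (Ne.symm hS)⟩
  · intro T hT
    rw [← h T hT, filter_image, sum_image (fun a _ b _ hab => (Prod.mk.inj hab).1), filter_filter]
    rw [← sum_fiberwise_of_maps_to (g := s) (t := I.image s)
      (fun i hi => mem_image_of_mem s (mem_filter.1 hi).1)]
    simp_rw [filter_filter]
    rw [sum_filter]
    refine sum_congr rfl fun S _ => ?_
    split_ifs with hS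
    · rw [hW]
      refine sum_congr (filter_congr fun i _ => ?_) fun _ _ => rfl
      exact ⟨fun h => ⟨h ▸ hS.2, h⟩, fun h => h.2⟩
    · by_cases hTS : T ∈ S.edges
      · have hWS : W S = 0 := by
          by_contra h0
          exact hS ⟨h0, hTS⟩
        rw [← hWS, hW]
        refine sum_congr (filter_congr fun i _ => ?_) fun _ _ => rfl
        exact ⟨fun h => ⟨h ▸ hTS, h⟩, fun h => h.2⟩
      · rw [eq_comm]
        refine sum_eq_zero fun i hi => ?_
        have := (mem_filter.1 hi).2
        exact absurd (this.2 ▸ this.1) hTS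

open Finset in
theorem exists_perm_map_eq {X : Type*} [Fintype X] [DecidableEq X] {A B : Finset X}
    (h : A.card = B.card) : ∃ σ : Equiv.Perm X, A.map σ.toEmbedding = B := by
  obtain ⟨σ, hσ⟩ : ∃ σ : Equiv.Perm X, ∀ x ∈ A, σ x ∈ B :=
    ⟨(equivOfCardEq h).extendSubtype, fun x hx => Equiv.extendSubtype_mem _ x hx⟩
  refine ⟨σ, eq_of_subset_of_card_le ?_ (by rw [card_map, h])⟩
  intro y hy
  obtain ⟨x, hx, rfl⟩ := mem_map.1 hy
  exact hσ x hx

open Finset in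
/-- The number of permutations carrying an edge of `H` onto a given `t`-set does not depend on
that set. -/
theorem exists_card_perm_eq {t : ℕ} {X : Type*} [Fintype X] [DecidableEq X] (H : TGraph t X)
    (hH : H.edges.Nonempty) : ∃ c : ℕ, 0 < c ∧ ∀ A : Finset X, A.card = t →
      #{σ : Equiv.Perm X | A.map σ.toEmbedding ∈ H.edges} = c := by
  obtain ⟨E, hE⟩ := hH
  refine ⟨#{σ : Equiv.Perm X | E.map σ.toEmbedding ∈ H.edges}, ?_, fun A hA => ?_⟩
  · refine card_pos.2 ⟨Equiv.refl X, ?_⟩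
    simp only [mem_filter, mem_univ, true_and]
    convert hE
    ext x; simp
  · obtain ⟨τ, hτ⟩ := exists_perm_map_eq (hA.trans (H.card_edge E hE).symm)
    -- Permutations act transitively on $t$-sets, so translation by $\tau^{-1}$ matches the counts
    -- for $A$ and $E$.
    refine card_equiv (Equiv.mulRight τ⁻¹) fun σ => ?_
    simp only [mem_filter, mem_univ, true_and, Equiv.coe_mulRight]
    rw [← hτ, map_map]
    have : τ.toEmbedding.trans (σ * τ⁻¹).toEmbedding = σ.toEmbedding := by
      ext x; simp
    rw [this]

/-- The copy of `H` in `G` placed on a clique through a bijection with the vertices of `H`. -/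
def copyOn {t : ℕ} {V X : Type*} (G : TGraph t V) (H : TGraph t X) {K : Finset V}
    (hK : G.IsClique K) (f : X ≃ {x // x ∈ K}) : G.Subgraph where
  verts := K
  edges := H.edges.map (Finset.mapEmbedding
    (f.toEmbedding.trans (Function.Embedding.subtype _))).toEmbedding
  edges_subset := by
    intro T hT
    obtain ⟨E, hE, rfl⟩ := Finset.mem_map.1 hT
    refine hK (Finset.mem_powersetCard.2 ⟨?_, ?_⟩)
    · intro x hx
      obtain ⟨y, -, rfl⟩ := Finset.mem_map.1 hx
      exact (f y).2
    · exact (Finset.card_map _).trans (H.card_edge E hE)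
  edge_subset_verts := by
    intro T hT x hx
    obtain ⟨E, hE, rfl⟩ := Finset.mem_map.1 hT
    obtain ⟨y, -, rfl⟩ := Finset.mem_map.1 hx
    exact (f y).2

theorem copyOn_isCopy {t : ℕ} {V X : Type*} (G : TGraph t V) (H : TGraph t X) {K : Finset V}
    (hK : G.IsClique K) (f : X ≃ {x // x ∈ K}) : (G.copyOn H hK f).IsCopy H :=
  ⟨f, fun _ => (Finset.mem_map' (Finset.mapEmbedding _).toEmbedding).symm⟩

-- Since the count `c` is the same for every $T\subseteq K$, giving each placement weight $w(K)/c$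
-- passes exactly $w(K)$ to each $t$-subset of $K$.
open Finset in
theorem card_copyOn_containing {t : ℕ} {V X : Type*} [Fintype X] [DecidableEq X] [DecidableEq V]
    (G : TGraph t V) (H : TGraph t X) {K : Finset V} (hK : G.IsClique K) (f : X ≃ {x // x ∈ K})
    {c : ℕ} (hc : ∀ A : Finset X, A.card = t →
      #{σ : Equiv.Perm X | A.map σ.toEmbedding ∈ H.edges} = c)
    {T : Finset V} (hT : T.card = t) :
    #{σ : Equiv.Perm X | T ∈ (G.copyOn H hK (σ.trans f)).edges} = if T ⊆ K then c else 0 := by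
  split_ifs with hTK
  · set g : X ↪ V := f.toEmbedding.trans (Function.Embedding.subtype _) with hg
    obtain ⟨A, rfl⟩ : ∃ A : Finset X, A.map g = T := by
      refine ⟨univ.filter fun x => g x ∈ T, ?_⟩
      ext y
      simp only [mem_map, mem_filter, mem_univ, true_and]
      refine ⟨?_, fun hy => ⟨f.symm ⟨y, hTK hy⟩, ?_, ?_⟩⟩
      · rintro ⟨x, hx, rfl⟩; exact hx
      · simpa [hg] using hy
      · simp [hg]
    rw [card_map] at hT
    rw [← hc A hT]
    refine card_equiv (Equiv.inv _) fun σ => ?_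
    simp only [mem_filter, mem_univ, true_and, Equiv.inv_apply, copyOn, mem_map]
    constructor
    · rintro ⟨E, hE, h⟩
      have h' : (E.map σ.toEmbedding).map g = A.map g := by
        rw [← h, map_map]; rfl
      rw [← map_injective g h', map_map]
      convert hE
      ext x; simp
    · intro hA
      refine ⟨_, hA, ?_⟩
      change Finset.map _ (Finset.map _ A) = _
      rw [map_map]
      congr 1
      ext x; simp [hg]
  · rw [card_eq_zero, filter_eq_empty_iff]
    exact fun σ _ h => hTK ((G.copyOn H hK (σ.trans f)).edge_subset_verts T h)

open Finset in
theorem hasRationalDecomposition_of_clique_weights {t k : ℕ} {V X : Type*} [Fintype V]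
    [DecidableEq V] [Fintype X] (hX : Fintype.card X = k) {G : TGraph t V} {H : TGraph t X}
    (hH : H.edges.Nonempty) (w : Finset V → ℚ) (hw : ∀ K, K.card = k → 0 ≤ w K)
    (h : ∀ T ∈ G.edges, ∑ K ∈ powersetCard k univ with G.IsClique K ∧ T ⊆ K, w K = 1) :
    G.HasRationalDecomposition H := by
  classical
  obtain ⟨c, hc0, hc⟩ := H.exists_card_perm_eq hH
  have hf : ∀ K : {K : Finset V // K.card = k ∧ G.IsClique K}, Nonempty (X ≃ {x // x ∈ K.1}) :=
    fun K => ⟨Fintype.equivOfCardEq (by rw [hX, Fintype.card_coe, K.2.1])⟩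
  let f := fun K => (hf K).some
  refine hasRationalDecomposition_of_weights (univ : Finset
      ({K : Finset V // K.card = k ∧ G.IsClique K} × Equiv.Perm X))
    (fun i => G.copyOn H i.1.2.2 (i.2.trans (f i.1))) (fun i => w i.1 / c)
    (fun i _ => G.copyOn_isCopy H _ _) (fun i _ => div_nonneg (hw _ i.1.2.1) (by positivity)) ?_
  intro T hT
  rw [← h T hT, sum_filter, Fintype.sum_prod_type]
  have hin : ∀ K : {K : Finset V // K.card = k ∧ G.IsClique K},
      ∑ σ : Equiv.Perm X, (if T ∈ (G.copyOn H K.2.2 (σ.trans (f K))).edges then w K / c else 0) =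
        if T ⊆ K.1 then w K else 0 := by
    intro K
    rw [← sum_filter, sum_const,
      G.card_copyOn_containing H K.2.2 (f K) hc (G.card_edge T hT), nsmul_eq_mul]
    have : (c : ℚ) ≠ 0 := by exact_mod_cast hc0.ne'
    split_ifs
    · field_simp
    · simp
  rw [sum_congr rfl fun K _ => hin K, ← filter_filter, sum_filter]
  refine (sum_subtype _ (p := fun K : Finset V => K.card = k ∧ G.IsClique K) ?_
    (fun K => if T ⊆ K then w K else 0)).symm
  intro K
  simp [mem_powersetCard]

open Finset in
theorem sum_one_cliques_self {t : ℕ} {V : Type*} [Fintype V] [DecidableEq V]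
    (G : TGraph t V) {T : Finset V} (hT : T ∈ G.edges) :
    ∑ K ∈ powersetCard t univ with G.IsClique K ∧ T ⊆ K, (1 : ℚ) = 1 := by
  have : {K ∈ powersetCard t (univ : Finset V) | G.IsClique K ∧ T ⊆ K} = {T} := by
    ext K
    simp only [mem_filter, mem_powersetCard, subset_univ, true_and, mem_singleton]
    constructor
    · rintro ⟨h1, -, h2⟩
      exact (eq_of_subset_of_card_le h2 (by rw [h1, G.card_edge T hT])).symm
    · rintro rfl
      refine ⟨G.card_edge K hT, ?_, le_rfl⟩
      intro S hS
      rw [mem_powersetCard] at hS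
      rwa [eq_of_subset_of_card_le hS.1 (by rw [hS.2, G.card_edge K hT])]
  rw [this, sum_singleton]

/-! ### Choice of constants and conclusion. -/

open Finset in
theorem IsDense.exists_clique_weights {t k : ℕ} (ht : 1 ≤ t) (htk : t ≤ k) {V : Type*}
    [Fintype V] [DecidableEq V] {G : TGraph t V} {ε : ℝ} (hv : t + 2 * k ≤ Fintype.card V)
    (hε : ε * (2 ^ (t + 2) * (k : ℝ) ^ (2 * t)) ≤ 1) (hG : G.IsDense ε) :
    ∃ w : Finset V → ℚ, (∀ K, K.card = k → 0 ≤ w K) ∧ ∀ T ∈ G.edges,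
      ∑ K ∈ powersetCard k univ with G.IsClique K ∧ T ⊆ K, w K = 1 := by
  -- For $k=t$ the factor $k-t$ kills the gadget, but each edge is itself a clique and weight $1$
  -- suffices.
  rcases htk.eq_or_lt with rfl | htk
  · exact ⟨fun _ => 1, fun _ _ => zero_le_one, fun T hT => G.sum_one_cliques_self hT⟩
  have hk1 : (1 : ℝ) ≤ k := by exact_mod_cast (show 1 ≤ k by omega)
  have hkt : (1 : ℝ) ≤ (k : ℝ) ^ t := one_le_pow₀ hk1
  refine G.exists_clique_weights htk (by omega) (fun e he => ?_) fun e he => ?_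
  · obtain ⟨hε0, h⟩ := hG.card_nonclique_le ht he (k - t) (by omega)
    rw [show t + (k - t) = k by omega] at h
    have hch : ((k.choose t : ℕ) : ℝ) ≤ (k : ℝ) ^ t := by exact_mod_cast Nat.choose_le_pow k t
    set b := #{S ∈ powersetCard (k - t) (univ \ e) | ¬ G.IsClique (e ∪ S)}
    set P := (Fintype.card V - t).choose (k - t)
    have : (b : ℝ) * (2 ^ (t + 1) * k.choose t) ≤ P := by
      calc (b : ℝ) * (2 ^ (t + 1) * k.choose t)
          ≤ (2 * ε * k ^ t * P) * (2 ^ (t + 1) * k ^ t) := by gcongr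
        _ = (ε * (2 ^ (t + 2) * (k : ℝ) ^ (2 * t))) * P := by ring
        _ ≤ 1 * P := by gcongr
        _ = P := one_mul _
    exact_mod_cast this
  · obtain ⟨hε0, h⟩ := hG.card_nonclique_le ht he k (by omega)
    set b := #{S ∈ powersetCard k (univ \ e) | ¬ G.IsClique (e ∪ S)}
    set M := (Fintype.card V - t).choose k
    have hpow : ((t + k : ℕ) : ℝ) ^ t ≤ 2 ^ t * k ^ (2 * t) := by
      have : ((t + k : ℕ) : ℝ) ≤ 2 * k := by exact_mod_cast (show t + k ≤ 2 * k by omega)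
      calc ((t + k : ℕ) : ℝ) ^ t ≤ (2 * k) ^ t := by gcongr
        _ = 2 ^ t * (k ^ t * 1) := by rw [mul_one, mul_pow]
        _ ≤ 2 ^ t * (k ^ t * k ^ t) := by gcongr
        _ = 2 ^ t * k ^ (2 * t) := by ring
    have : 2 * (b : ℝ) ≤ M := by
      calc 2 * (b : ℝ) ≤ 2 * (2 * ε * (2 ^ t * k ^ (2 * t)) * M) := by
            refine mul_le_mul_of_nonneg_left (h.trans ?_) zero_le_two
            gcongr
        _ = (ε * (2 ^ (t + 2) * (k : ℝ) ^ (2 * t))) * M := by ring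
        _ ≤ 1 * M := by gcongr
        _ = M := one_mul _
    exact_mod_cast this

end TGraph

theorem theorem1 (t : ℕ) (ht : 2 ≤ t) :
    ∃ C : ℝ, 0 < C ∧ ∀ k : ℕ, t ≤ k → ∃ v₀ : ℕ,
      ∀ (V : Type*) [Fintype V] [DecidableEq V], v₀ < Fintype.card V →
        ∀ ε : ℝ, ε < C * (k : ℝ) ^ (-(2 * (t : ℤ))) →
          ∀ G : TGraph t V, G.IsDense ε →
            G.HasRationalDecomposition (TGraph.complete t (Fin k)) ∧
              ∀ (X : Type*) [Fintype X], Fintype.card X = k →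
                ∀ H : TGraph t X, H.edges.Nonempty → G.HasRationalDecomposition H := by
  -- Both requirements on $\epsilon$ lead to $2^{t+2}$: as $2\cdot 2^{t+1}$ for $k$-cliques, and as
  -- $2\cdot2\cdot2^t$ for $(k+t)$-cliques, using $(t+k)^t\le 2^tk^{2t}$.
  refine ⟨1 / 2 ^ (t + 2), by positivity, fun k htk => ⟨t + 2 * k, ?_⟩⟩
  intro V _ _ hv ε hε G hG
  have hk : (0 : ℝ) < k := by exact_mod_cast (show 0 < k by omega)
  have hε' : ε * (2 ^ (t + 2) * (k : ℝ) ^ (2 * t)) ≤ 1 := by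
    have hz : (k : ℝ) ^ (-(2 * (t : ℤ))) = ((k : ℝ) ^ (2 * t))⁻¹ := by
      rw [zpow_neg]; norm_cast
    rw [hz] at hε
    calc ε * (2 ^ (t + 2) * (k : ℝ) ^ (2 * t))
        ≤ (1 / 2 ^ (t + 2) * ((k : ℝ) ^ (2 * t))⁻¹) * (2 ^ (t + 2) * (k : ℝ) ^ (2 * t)) := by
          gcongr
      _ = 1 := by field_simp
  obtain ⟨w, hw0, hw⟩ := hG.exists_clique_weights (by omega) htk hv.le hε'
  refine ⟨TGraph.hasRationalDecomposition_of_clique_weights (Fintype.card_fin k) ?_ w hw0 hw,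
    fun X _ hX H hH => TGraph.hasRationalDecomposition_of_clique_weights hX hH w hw0 hw⟩
  exact Finset.powersetCard_nonempty.2 (by simpa using htk)
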